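/- A quasi-norm on a real or complex linear space $V$ is a function $\|\cdot\|:V\to[0,\infty)$ with $\|f\|=0\iff f=0$, $\|-f\|=\|f\|$ and $\|f_1+f_2\|\le c\,(\|f_1\|+\|f_2\|)$ for some constant $c>1$ (homogeneity is not required). For quasi-normed linear subspaces $E,F$ of a common linear space, $f\in E+F$ and $t>0$, put $$K(f,t,E,F)=\inf_{f=f_0+f_1,\ f_0\in E,\ f_1\in F}\bigl(\|f_0\|_E+t\|f_1\|_F\bigr),\qquad \mathcal E(f,t,E,F)=\inf_{g\in F,\ \|g\|_F\le t}\|f-g\|_E ,$$ where $\|f-g\|_E=\infty$ if $f-g\notin E$. For $0<\theta<1$, $\alpha>0$ and $0<q\le\infty$, let $(E,F)^K_{\theta,q}$ and $\mathcal E_{\alpha,q}(E,F)$ be the sets of all $f\in E+F$ for which, respectively, $$\|f\|_{(E,F)^K_{\theta,q}}=\Bigl(\int_0^\infty\bigl(t^{-\theta}K(f,t,E,F)\bigr)^q\frac{dt}{t}\Bigr)^{1/q},\qquad \|f\|_{\mathcal E_{\alpha,q}(E,F)}=\Bigl(\int_0^\infty\bigl(t^{\alpha}\mathcal E(f,t,E,F)\bigr)^q\frac{dt}{t}\Bigr)^{1/q}$$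 is finite; for $q=\infty$ these expressions are read as $\sup_{t>0}t^{-\theta}K(f,t,E,F)$ and $\sup_{t>0}t^{\alpha}\mathcal E(f,t,E,F)$. **Theorem 3.4.** Let $\mathcal T\subset F\subset E$ be quasi-normed linear spaces (each a linear subspace of the next, with its own quasi-norm), and let $E$ and $F$ be complete. (1) If there exist $C>0$ and $\beta>0$ such that the Jackson-type inequality $$t^\beta\,\mathcal E(f,t,E,\mathcal T)\le C\|f\|_F\qquad (f\in F,\ t>0)$$ holds, then for all $0<\theta<1$ and $0<q\le\infty$ one has the embedding $(E,F)^K_{\theta,q}\subset\mathcal E_{\theta\beta,q}(E,\mathcal T)$. (2) If there exist $C>0$ and $\beta>0$ such that the Bernstein-type inequality $$\|f\|_F\le C\,\|f\|_{\mathcal T}^{\beta}\,\|f\|_E\qquad (f\in\mathcal T)$$ holds, then for all $0<\theta<1$ and $0<q\le\infty$ one has the embedding $\mathcal E_{\theta\beta,q}(E,\mathcal T)\subset(E,F)^K_{\theta,q}$. Here an embedding $X\subset Y$ means that $X$ is contained in $Y$ as a set and that there is a constant $C'>0$ with $\|f\|_Y\le C'\|f\|_X$ for all $f\in X$. -/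

import Mathlib

open scoped ENNReal

/-- A quasi-norm on the additive group of a linear space. Homogeneity under scalars is not part
of the notion, so powers of norms are quasi-norms as well. -/
structure QuasiNorm (V : Type*) [AddCommGroup V] where
  toFun : V → ℝ
  nonneg : ∀ f, 0 ≤ toFun f
  eq_zero_iff : ∀ f, toFun f = 0 ↔ f = 0
  map_neg : ∀ f, toFun (-f) = toFun f
  exists_quasi_triangle :
    ∃ C : ℝ, 1 < C ∧ ∀ f₁ f₂, toFun (f₁ + f₂) ≤ C * (toFun f₁ + toFun f₂)

/-- A quasi-normed linear space, realized as a linear subspace of an ambient linear space `A`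
(the ambient space itself carries no topology). -/
structure QuasiNormedSubspace (𝕜 A : Type*) [Field 𝕜] [AddCommGroup A] [Module 𝕜 A] where
  carrier : Submodule 𝕜 A
  qnorm : QuasiNorm carrier

section

variable {𝕜 A : Type*} [Field 𝕜] [AddCommGroup A] [Module 𝕜 A]

/-- The quasi-norm `‖f‖_E` of an element of `E`. -/
def QuasiNormedSubspace.norm (E : QuasiNormedSubspace 𝕜 A) (f : E.carrier) : ℝ :=
  E.qnorm.toFun f

/-- Every Cauchy sequence for the quasi-norm converges in the quasi-norm. -/
def QuasiNormedSubspace.IsComplete (E : QuasiNormedSubspace 𝕜 A) : Prop :=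
  ∀ u : ℕ → E.carrier,
    (∀ ε > 0, ∃ N, ∀ m ≥ N, ∀ n ≥ N, E.norm (u m - u n) < ε) →
    ∃ f : E.carrier, ∀ ε > 0, ∃ N, ∀ n ≥ N, E.norm (u n - f) < ε

open scoped Classical in
/-- The quasi-norm of `E` extended to the ambient space by the value `∞` outside `E`. -/
noncomputable def QuasiNormedSubspace.extNorm (E : QuasiNormedSubspace 𝕜 A) (f : A) : ℝ≥0∞ :=
  if h : f ∈ E.carrier then ENNReal.ofReal (E.norm ⟨f, h⟩) else ∞

/-- The functional `(∫₀^∞ φ(t)^q dt/t)^(1/q)` for `0 < q < ∞`, and `sup_{t > 0} φ(t)` for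
`q = ∞`. -/
noncomputable def haarLpNorm (q : ℝ≥0∞) (φ : ℝ → ℝ≥0∞) : ℝ≥0∞ :=
  if q = ∞ then ⨆ t ∈ Set.Ioi (0 : ℝ), φ t
  else (∫⁻ t in Set.Ioi (0 : ℝ), φ t ^ q.toReal * ENNReal.ofReal t⁻¹) ^ (1 / q.toReal)

/-- Peetre's functional
`K(f, t, E, F) = inf {‖f₀‖_E + t ‖f₁‖_F : f = f₀ + f₁, f₀ ∈ E, f₁ ∈ F}`. -/
noncomputable def peetreK (E F : QuasiNormedSubspace 𝕜 A) (f : A) (t : ℝ) : ℝ≥0∞ :=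
  ⨅ (f₀ : E.carrier) (f₁ : F.carrier) (_ : f = (f₀ : A) + (f₁ : A)),
    ENNReal.ofReal (E.norm f₀ + t * F.norm f₁)

/-- The quasi-norm of `(E, F)^K_{θ,q}`, with the value `∞` allowed. -/
noncomputable def interpNorm (E F : QuasiNormedSubspace 𝕜 A) (θ : ℝ) (q : ℝ≥0∞) (f : A) : ℝ≥0∞ :=
  haarLpNorm q fun t => ENNReal.ofReal (t ^ (-θ)) * peetreK E F f t

/-- The interpolation space `(E, F)^K_{θ,q}`. -/
def interpSpace (E F : QuasiNormedSubspace 𝕜 A) (θ : ℝ) (q : ℝ≥0∞) : Set A :=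
  {f | f ∈ E.carrier ⊔ F.carrier ∧ interpNorm E F θ q f < ∞}

/-- The error of best approximation
`inf {‖f - g‖_E : g ∈ F, ‖g‖_F ≤ t}`. -/
noncomputable def approxError (E F : QuasiNormedSubspace 𝕜 A) (f : A) (t : ℝ) : ℝ≥0∞ :=
  ⨅ (g : F.carrier) (_ : F.norm g ≤ t), E.extNorm (f - (g : A))

/-- The quasi-norm of the approximation space with parameters `α, q`, with the value `∞`
allowed. -/
noncomputable def approxNorm (E F : QuasiNormedSubspace 𝕜 A) (α : ℝ) (q : ℝ≥0∞) (f : A) : ℝ≥0∞ :=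
  haarLpNorm q fun t => ENNReal.ofReal (t ^ α) * approxError E F f t

/-- The approximation space with parameters `α, q` of the pair `E, F`. -/
def approxSpace (E F : QuasiNormedSubspace 𝕜 A) (α : ℝ) (q : ℝ≥0∞) : Set A :=
  {f | f ∈ E.carrier ⊔ F.carrier ∧ approxNorm E F α q f < ∞}

end

/-!
Both embeddings come from a pointwise comparison of the two functionals at the points `t` and
`t ^ (-β)`, followed by a change of variables in the Haar integral
(`haarLpNorm_comp_rpow`, `haarLpNorm_comp_mul_left`).

*Jackson.* If `f = f₀ + f₁`, approximating `f₁` alone gives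
`𝓔(f, t) ≤ c (‖f₀‖_E + 𝓔(f₁, t)) ≤ c (‖f₀‖_E + C t^(-β) ‖f₁‖_F)`, hence
`𝓔(f, t) ≤ D K(f, t^(-β))` (`exists_approxError_le_peetreK`).

*Bernstein.* Fix `s > 0` and a small ratio `x`, and choose near-best approximants `g j ∈ T` of `f`
with `‖g j‖_T ≤ x ^ j * s`. In the decomposition `f = (f - g 0) + g 0` write `g 0` as the
telescoping sum of the differences `g j - g (j + 1)`. The Bernstein inequality bounds each of them
in `F`, and the `j`-fold use of the quasi-triangle inequality costs a factor `cF ^ j` only. With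
`ρ = cF * x ^ β` this yields `K(f, s^(-β)) ≤ D ∑ j, ρ ^ j 𝓔(f, x ^ j * s)`
(`exists_peetreK_le_tsum_approxError`). The remainder `cF ^ N * ‖g N‖_F` tends to `0` by the
Bernstein inequality again, so finite sums are enough. Taking `x` so small that
`ρ * x ^ (-θβ) = 1 / 4` beats the factors `cF ^ j` without an equivalent `p`-norm, and the weighted
geometric series of dilates is bounded on every `haarLpNorm q`
(`exists_haarLpNorm_geometric_sum_le`).
-/

/-! ### The functional `haarLpNorm` under dilations, powers and geometric sums -/

theorem haarLpNorm_mono {q : ℝ≥0∞} {φ ψ : ℝ → ℝ≥0∞} (h : ∀ t, 0 < t → φ t ≤ ψ t) :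
    haarLpNorm q φ ≤ haarLpNorm q ψ := by
  unfold haarLpNorm
  split_ifs with hq
  · exact iSup₂_mono h
  · refine ENNReal.rpow_le_rpow ?_ (by positivity)
    refine MeasureTheory.setLIntegral_mono' measurableSet_Ioi fun t ht => ?_
    gcongr
    exact h t ht

theorem haarLpNorm_const_mul {q : ℝ≥0∞} (hq0 : 0 < q) {a : ℝ≥0∞} (ha : a ≠ ∞) (φ : ℝ → ℝ≥0∞) :
    haarLpNorm q (fun t => a * φ t) = a * haarLpNorm q φ := by
  unfold haarLpNorm
  split_ifs with hq
  · simp only [ENNReal.mul_iSup]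
  · have hq' : 0 < q.toReal := ENNReal.toReal_pos hq0.ne' hq
    have h0 : (0 : ℝ) ≤ 1 / q.toReal := by positivity
    simp only [ENNReal.mul_rpow_of_nonneg _ _ hq'.le, mul_assoc]
    rw [MeasureTheory.lintegral_const_mul' _ _ (ENNReal.rpow_ne_top_of_nonneg hq'.le ha),
      ENNReal.mul_rpow_of_nonneg _ _ h0, ← ENNReal.rpow_mul, mul_one_div_cancel hq'.ne',
      ENNReal.rpow_one]

theorem haarLpNorm_comp_mul_left (q : ℝ≥0∞) {a : ℝ} (ha : 0 < a) (φ : ℝ → ℝ≥0∞) :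
    haarLpNorm q (fun t => φ (a * t)) = haarLpNorm q φ := by
  have himg : (fun t => a * t) '' Set.Ioi (0 : ℝ) = Set.Ioi 0 := by
    ext y
    constructor
    · rintro ⟨t, ht, rfl⟩
      exact mul_pos ha ht
    · intro hy
      exact ⟨a⁻¹ * y, mul_pos (inv_pos.mpr ha) hy, mul_inv_cancel_left₀ ha.ne' y⟩
  unfold haarLpNorm
  split_ifs with hq
  · conv_rhs => rw [← himg, iSup_image]
  · congr 1
    conv_rhs => rw [← himg]
    rw [MeasureTheory.lintegral_image_eq_lintegral_abs_deriv_mul measurableSet_Ioi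
      (f := fun t => a * t) (f' := fun _ => a)
      (fun t _ => ((hasDerivAt_id t).const_mul a |>.congr_deriv (mul_one a)).hasDerivWithinAt)
      (fun x _ y _ h => mul_left_cancel₀ ha.ne' h)]
    refine MeasureTheory.setLIntegral_congr_fun measurableSet_Ioi fun t (ht : 0 < t) => ?_
    dsimp only
    rw [mul_left_comm, ← ENNReal.ofReal_mul (abs_nonneg a), abs_of_pos ha, mul_inv,
      mul_inv_cancel_left₀ ha.ne']

theorem haarLpNorm_comp_rpow (q : ℝ≥0∞) {p : ℝ} (hp : p ≠ 0) (φ : ℝ → ℝ≥0∞) :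
    haarLpNorm q (fun t => φ (t ^ p)) =
      ENNReal.ofReal |p|⁻¹ ^ (1 / q.toReal) * haarLpNorm q φ := by
  have himg : (fun t : ℝ => t ^ p) '' Set.Ioi (0 : ℝ) = Set.Ioi 0 := by
    ext y
    constructor
    · rintro ⟨t, ht, rfl⟩
      exact Real.rpow_pos_of_pos ht p
    · intro hy
      exact ⟨y ^ p⁻¹, Real.rpow_pos_of_pos hy _, Real.rpow_inv_rpow (le_of_lt hy) hp⟩
  unfold haarLpNorm
  split_ifs with hq
  · conv_rhs => rw [← himg, iSup_image]
    simp [hq]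
  · rw [← ENNReal.mul_rpow_of_nonneg _ _ (by positivity)]
    congr 1
    conv_rhs => rw [← himg]
    rw [MeasureTheory.lintegral_image_eq_lintegral_abs_deriv_mul measurableSet_Ioi
      (fun t ht => (Real.hasDerivAt_rpow_const (Or.inl (ne_of_gt ht))).hasDerivWithinAt)
      (fun x (hx : 0 < x) y (hy : 0 < y) h => Real.rpow_left_injOn hp hx.le hy.le h),
      ← MeasureTheory.lintegral_const_mul' _ _ ENNReal.ofReal_ne_top]
    refine MeasureTheory.setLIntegral_congr_fun measurableSet_Ioi fun t (ht : 0 < t) => ?_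
    dsimp only
    rw [mul_left_comm (ENNReal.ofReal |p * _|), ← ENNReal.ofReal_mul (abs_nonneg _),
      mul_left_comm, ← ENNReal.ofReal_mul (by positivity)]
    congr 2
    have hp' : |p| ≠ 0 := abs_ne_zero.mpr hp
    have htp : t ^ p ≠ 0 := (Real.rpow_pos_of_pos ht p).ne'
    rw [abs_mul, abs_of_pos (Real.rpow_pos_of_pos ht _), Real.rpow_sub_one ht.ne']
    field_simp

/-- Half of the weight `r ^ (2 * j)` is spent on summability and half on bounding the supremum of
`r ^ j * x j` by an `ℓ^p` sum. This treats `p < 1` and `p ≥ 1` alike. -/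
theorem ENNReal.tsum_mul_rpow_le {r : ℝ≥0∞} {p : ℝ} (hp : 0 < p) (x : ℕ → ℝ≥0∞) :
    (∑' j, (r ^ j * r ^ j) * x j) ^ p ≤ (∑' j, r ^ j) ^ p * ∑' j, (r ^ p) ^ j * x j ^ p := by
  have h1 : ∑' j, (r ^ j * r ^ j) * x j ≤ (∑' j, r ^ j) * ⨆ j, r ^ j * x j := by
    rw [← ENNReal.tsum_mul_right]
    refine ENNReal.tsum_le_tsum fun j => ?_
    rw [mul_assoc]
    gcongr
    exact le_iSup (fun j => r ^ j * x j) j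
  refine (ENNReal.rpow_le_rpow h1 hp.le).trans ?_
  rw [ENNReal.mul_rpow_of_nonneg _ _ hp.le]
  gcongr
  rw [← ENNReal.le_rpow_inv_iff hp]
  refine iSup_le fun j => ?_
  rw [ENNReal.le_rpow_inv_iff hp, ENNReal.mul_rpow_of_nonneg _ _ hp.le, ← ENNReal.rpow_natCast_mul,
    mul_comm (j : ℝ), ENNReal.rpow_mul_natCast]
  exact ENNReal.le_tsum j

/-- Geometrically weighted sums of dilates are bounded on `haarLpNorm q` for all `0 < q ≤ ∞`, since
each dilate has the same `haarLpNorm`. The weight is written as a square for the application of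
`ENNReal.tsum_mul_rpow_le`. -/
theorem exists_haarLpNorm_geometric_sum_le {q : ℝ≥0∞} (hq0 : 0 < q) {r : ℝ≥0∞} (hr : r < 1) {x : ℝ}
    (hx : 0 < x) :
    ∃ M : ℝ≥0∞, M ≠ ∞ ∧ ∀ φ : ℝ → ℝ≥0∞, Measurable φ →
      haarLpNorm q (fun t => ∑' j : ℕ, (r ^ j * r ^ j) * φ (x ^ j * t)) ≤ M * haarLpNorm q φ := by
  have hgeom : ∀ {s : ℝ≥0∞}, s < 1 → ∑' j : ℕ, s ^ j ≠ ∞ := fun hs => by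
    rw [ENNReal.tsum_geometric]
    exact ENNReal.inv_ne_top.mpr (tsub_pos_of_lt hs).ne'
  by_cases hq : q = ∞
  · subst hq
    refine ⟨∑' j : ℕ, r ^ j, hgeom hr, fun φ _ => ?_⟩
    simp only [haarLpNorm, if_true]
    refine iSup₂_le fun t (ht : 0 < t) => ?_
    rw [← ENNReal.tsum_mul_right]
    refine ENNReal.tsum_le_tsum fun j => ?_
    gcongr
    · exact mul_le_of_le_one_right' (pow_le_one' hr.le j)
    · exact le_iSup₂ (f := fun t (_ : t ∈ Set.Ioi (0 : ℝ)) => φ t) (x ^ j * t)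
        (mul_pos (pow_pos hx j) ht)
  · have hq' : 0 < q.toReal := ENNReal.toReal_pos hq0.ne' hq
    set p := q.toReal with hp
    have h0 : (0 : ℝ) ≤ 1 / p := by positivity
    refine ⟨((∑' j : ℕ, r ^ j) ^ p * ∑' j : ℕ, (r ^ p) ^ j) ^ (1 / p), ?_, fun φ hφ => ?_⟩
    · exact ENNReal.rpow_ne_top_of_nonneg h0 (ENNReal.mul_ne_top
        (ENNReal.rpow_ne_top_of_nonneg hq'.le (hgeom hr))
        (hgeom (ENNReal.rpow_lt_one hr hq')))
    have hscale : ∀ j : ℕ, ∫⁻ t in Set.Ioi (0 : ℝ), φ (x ^ j * t) ^ p * ENNReal.ofReal t⁻¹ =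
        ∫⁻ t in Set.Ioi (0 : ℝ), φ t ^ p * ENNReal.ofReal t⁻¹ := fun j => by
      have h := haarLpNorm_comp_mul_left q (pow_pos hx j) φ
      simp only [haarLpNorm, if_neg hq] at h
      exact ENNReal.rpow_left_injective (one_div_pos.mpr hq').ne' h
    simp only [haarLpNorm, if_neg hq]
    rw [← hp, ← ENNReal.mul_rpow_of_nonneg _ _ h0]
    refine ENNReal.rpow_le_rpow ?_ h0
    calc ∫⁻ t in Set.Ioi (0 : ℝ), (∑' j : ℕ, (r ^ j * r ^ j) * φ (x ^ j * t)) ^ p *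
          ENNReal.ofReal t⁻¹
        ≤ ∫⁻ t in Set.Ioi (0 : ℝ), (∑' j : ℕ, r ^ j) ^ p * ∑' j : ℕ, (r ^ p) ^ j *
            (φ (x ^ j * t) ^ p * ENNReal.ofReal t⁻¹) := by
          refine MeasureTheory.lintegral_mono fun t => ?_
          simp only [← mul_assoc, ENNReal.tsum_mul_right]
          gcongr
          exact ENNReal.tsum_mul_rpow_le hq' _
      _ = (∑' j : ℕ, r ^ j) ^ p * ∑' j : ℕ, (r ^ p) ^ j *
            ∫⁻ t in Set.Ioi (0 : ℝ), φ (x ^ j * t) ^ p * ENNReal.ofReal t⁻¹ := by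
          have hmeas : ∀ j : ℕ, Measurable fun t : ℝ =>
              φ (x ^ j * t) ^ p * ENNReal.ofReal t⁻¹ := fun j => by fun_prop
          rw [MeasureTheory.lintegral_const_mul' _ _
            (ENNReal.rpow_ne_top_of_nonneg hq'.le (hgeom hr)),
            MeasureTheory.lintegral_tsum fun j => ((hmeas j).const_mul _).aemeasurable]
          simp only [MeasureTheory.lintegral_const_mul _ (hmeas _)]
      _ = _ := by
          simp only [hscale, ENNReal.tsum_mul_right]
          rw [mul_assoc]

/-! ### Quasi-normed subspaces -/

namespace QuasiNormedSubspace

variable {𝕜 A : Type*} [Field 𝕜] [AddCommGroup A] [Module 𝕜 A] (E : QuasiNormedSubspace 𝕜 A)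

theorem norm_nonneg (f : E.carrier) : 0 ≤ E.norm f := E.qnorm.nonneg f

theorem norm_zero : E.norm 0 = 0 := (E.qnorm.eq_zero_iff 0).mpr rfl

theorem norm_neg (f : E.carrier) : E.norm (-f) = E.norm f := E.qnorm.map_neg f

theorem exists_norm_add_le :
    ∃ c : ℝ, 1 < c ∧ ∀ f g, E.norm (f + g) ≤ c * (E.norm f + E.norm g) :=
  E.qnorm.exists_quasi_triangle

variable {E}

theorem norm_sub_le {c : ℝ} (hc : ∀ f g, E.norm (f + g) ≤ c * (E.norm f + E.norm g))
    (f g : E.carrier) : E.norm (f - g) ≤ c * (E.norm f + E.norm g) := by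
  simpa [sub_eq_add_neg, E.norm_neg] using hc f (-g)

/-- Peeling off one difference at a time, the `j`-th one is weighted by `c ^ (j + 1)`. -/
theorem norm_le_telescope {c : ℝ} (hc0 : 0 ≤ c)
    (hc : ∀ f g, E.norm (f + g) ≤ c * (E.norm f + E.norm g)) (u : ℕ → E.carrier) (N : ℕ) :
    E.norm (u 0) ≤
      ∑ j ∈ Finset.range N, c ^ (j + 1) * E.norm (u j - u (j + 1)) + c ^ N * E.norm (u N) := by
  induction N with
  | zero => simp
  | succ N ih =>
    have h := hc (u N - u (N + 1)) (u (N + 1))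
    rw [sub_add_cancel] at h
    rw [Finset.sum_range_succ]
    have h2 := mul_le_mul_of_nonneg_left h (pow_nonneg hc0 N)
    have h3 : c ^ N * (c * (E.norm (u N - u (N + 1)) + E.norm (u (N + 1)))) =
      c ^ (N + 1) * E.norm (u N - u (N + 1)) + c ^ (N + 1) * E.norm (u (N + 1)) := by ring
    linarith

variable (E) in
theorem extNorm_coe (f : E.carrier) : E.extNorm (f : A) = ENNReal.ofReal (E.norm f) := by
  simp [extNorm]

theorem extNorm_add_le {c : ℝ} (hc0 : 0 < c)
    (hc : ∀ f g, E.norm (f + g) ≤ c * (E.norm f + E.norm g)) (f g : A) :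
    E.extNorm (f + g) ≤ ENNReal.ofReal c * (E.extNorm f + E.extNorm g) := by
  have hc' : ENNReal.ofReal c ≠ 0 := (ENNReal.ofReal_pos.mpr hc0).ne'
  by_cases hf : f ∈ E.carrier
  · by_cases hg : g ∈ E.carrier
    · lift f to E.carrier using hf
      lift g to E.carrier using hg
      rw [← Submodule.coe_add, extNorm_coe, extNorm_coe, extNorm_coe,
        ← ENNReal.ofReal_add (E.norm_nonneg f) (E.norm_nonneg g), ← ENNReal.ofReal_mul hc0.le]
      exact ENNReal.ofReal_le_ofReal (hc f g)
    · simp [extNorm, hg, ENNReal.mul_top hc']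
  · simp [extNorm, hf, ENNReal.mul_top hc']

end QuasiNormedSubspace

/-! ### The error of best approximation and the Jackson inequality -/

section

variable {𝕜 A : Type*} [Field 𝕜] [AddCommGroup A] [Module 𝕜 A] {T F E : QuasiNormedSubspace 𝕜 A}

theorem approxError_antitone (f : A) : Antitone (approxError E T f) := fun _ _ hst =>
  le_iInf₂ fun g hg => iInf₂_le g (hg.trans hst)

theorem approxError_coe_le (f : E.carrier) {t : ℝ} (ht : 0 ≤ t) :
    approxError E T (f : A) t ≤ ENNReal.ofReal (E.norm f) := by
  refine (iInf₂_le (0 : T.carrier) (by rwa [T.norm_zero])).trans_eq ?_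
  simp [E.extNorm_coe]

/-- Near-best approximants. The error is finite because `0 ∈ T` is admissible, so that `toReal`
loses nothing. -/
theorem exists_norm_sub_le_approxError (hTE : T.carrier ≤ E.carrier) (f : E.carrier) {t η : ℝ}
    (ht : 0 ≤ t) (hη : 0 < η) :
    ∃ g : T.carrier, T.norm g ≤ t ∧
      E.norm (f - Submodule.inclusion hTE g) ≤ (approxError E T (f : A) t).toReal + η := by
  have hfin : approxError E T (f : A) t ≠ ∞ :=
    ((approxError_coe_le f ht).trans_lt ENNReal.ofReal_lt_top).ne
  have hlt : approxError E T (f : A) t < approxError E T (f : A) t + ENNReal.ofReal η :=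
    ENNReal.lt_add_right hfin (ENNReal.ofReal_pos.mpr hη).ne'
  conv_lhs at hlt => rw [approxError]
  obtain ⟨g, hg⟩ := iInf_lt_iff.mp hlt
  obtain ⟨hgt, hg⟩ := iInf_lt_iff.mp hg
  refine ⟨g, hgt, ?_⟩
  have hcoe : (f : A) - (g : A) = ((f - Submodule.inclusion hTE g : E.carrier) : A) := by simp
  rw [hcoe, E.extNorm_coe, ← ENNReal.ofReal_toReal hfin,
    ← ENNReal.ofReal_add ENNReal.toReal_nonneg hη.le] at hg
  simpa only [ENNReal.toReal_ofReal, ENNReal.ofReal_toReal hfin] using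
    (ENNReal.ofReal_le_ofReal_iff (by positivity)).mp hg.le

theorem approxError_add_le {c : ℝ} (hc0 : 0 < c)
    (hc : ∀ f g, E.norm (f + g) ≤ c * (E.norm f + E.norm g)) (f₀ : E.carrier) (f₁ : A) (t : ℝ) :
    approxError E T ((f₀ : A) + f₁) t ≤
      ENNReal.ofReal c * (ENNReal.ofReal (E.norm f₀) + approxError E T f₁ t) := by
  have hc' : ENNReal.ofReal c ≠ 0 := (ENNReal.ofReal_pos.mpr hc0).ne'
  rw [← E.extNorm_coe]
  conv_rhs => rw [approxError]
  simp only [ENNReal.add_iInf, ENNReal.mul_iInf_of_ne hc' ENNReal.ofReal_ne_top]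
  refine le_iInf₂ fun g hg => (iInf₂_le g hg).trans ?_
  rw [add_sub_assoc]
  exact QuasiNormedSubspace.extNorm_add_le hc0 hc _ _

theorem exists_approxError_le_peetreK {C β : ℝ} (hC : 0 < C)
    (hJ : ∀ f : F.carrier, ∀ t : ℝ, 0 < t →
      ENNReal.ofReal (t ^ β) * approxError E T (f : A) t ≤ ENNReal.ofReal (C * F.norm f)) :
    ∃ D : ℝ, 0 < D ∧ ∀ (f : A) (t : ℝ), 0 < t →
      approxError E T f t ≤ ENNReal.ofReal D * peetreK E F f (t ^ (-β)) := by
  obtain ⟨c, hc1, hc⟩ := E.exists_norm_add_le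
  have hc0 : 0 < c := one_pos.trans hc1
  have hD : 0 < c * (1 + C) := by positivity
  refine ⟨c * (1 + C), hD, fun f t ht => ?_⟩
  have hD' := (ENNReal.ofReal_pos.mpr hD).ne'
  simp only [peetreK, ENNReal.mul_iInf_of_ne hD' ENNReal.ofReal_ne_top]
  refine le_iInf fun f₀ => le_iInf fun f₁ => le_iInf fun hf => ?_
  have htβ : 0 < t ^ β := Real.rpow_pos_of_pos ht β
  have h₀ := E.norm_nonneg f₀
  have h₁ := F.norm_nonneg f₁
  have hJ' : approxError E T (f₁ : A) t ≤ ENNReal.ofReal (C * (t ^ (-β) * F.norm f₁)) := by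
    have h := hJ f₁ t ht
    rw [mul_comm, ← ENNReal.le_div_iff_mul_le (Or.inl (ENNReal.ofReal_pos.mpr htβ).ne')
      (Or.inl ENNReal.ofReal_ne_top), ← ENNReal.ofReal_div_of_pos htβ] at h
    refine h.trans_eq (congrArg _ ?_)
    rw [Real.rpow_neg ht.le]
    ring
  rw [hf]
  refine (approxError_add_le hc0 hc f₀ f₁ t).trans ?_
  have htβ' : 0 < t ^ (-β) := Real.rpow_pos_of_pos ht _
  calc ENNReal.ofReal c * (ENNReal.ofReal (E.norm f₀) + approxError E T (f₁ : A) t)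
      ≤ ENNReal.ofReal c * (ENNReal.ofReal (E.norm f₀) +
          ENNReal.ofReal (C * (t ^ (-β) * F.norm f₁))) := by gcongr
    _ = ENNReal.ofReal (c * (E.norm f₀ + C * (t ^ (-β) * F.norm f₁))) := by
        rw [← ENNReal.ofReal_add h₀ (by positivity), ← ENNReal.ofReal_mul hc0.le]
    _ ≤ ENNReal.ofReal (c * (1 + C)) * ENNReal.ofReal (E.norm f₀ + t ^ (-β) * F.norm f₁) := by
        rw [← ENNReal.ofReal_mul hD.le, mul_assoc]
        refine ENNReal.ofReal_le_ofReal (mul_le_mul_of_nonneg_left ?_ hc0.le)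
        have : 0 ≤ t ^ (-β) * F.norm f₁ := by positivity
        nlinarith [mul_nonneg hC.le h₀]

/-! ### The Bernstein inequality -/

theorem sum_geometric_mul_shift_le {ρ : ℝ} (hρ : 0 < ρ) {d : ℕ → ℝ} (hd : ∀ j, 0 ≤ d j) (N : ℕ) :
    ∑ j ∈ Finset.range N, ρ ^ j * (d j + d (j + 1)) ≤
      (1 + ρ⁻¹) * ∑ j ∈ Finset.range (N + 1), ρ ^ j * d j := by
  have h1 : ∑ j ∈ Finset.range N, ρ ^ j * d j ≤ ∑ j ∈ Finset.range (N + 1), ρ ^ j * d j := by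
    rw [Finset.sum_range_succ]
    have := hd N
    linarith [show 0 ≤ ρ ^ N * d N by positivity]
  have h2 : ∑ j ∈ Finset.range N, ρ ^ (j + 1) * d (j + 1) ≤
      ∑ j ∈ Finset.range (N + 1), ρ ^ j * d j := by
    rw [Finset.sum_range_succ']
    have := hd 0
    linarith [show 0 ≤ ρ ^ 0 * d 0 by positivity]
  have h3 : ∑ j ∈ Finset.range N, ρ ^ j * (d j + d (j + 1)) =
      ∑ j ∈ Finset.range N, ρ ^ j * d j +
        ρ⁻¹ * ∑ j ∈ Finset.range N, ρ ^ (j + 1) * d (j + 1) := by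
    rw [Finset.mul_sum, ← Finset.sum_add_distrib]
    refine Finset.sum_congr rfl fun j _ => ?_
    rw [pow_succ]
    field_simp
  rw [h3, add_mul, one_mul]
  gcongr

/-- The telescoping estimate for an arbitrary sequence `g` in `T` with `‖g j‖_T ≤ x ^ j * s`. The
summand with `(cF * x ^ β) ^ N` comes from bounding `‖g N‖_E` by `‖f - g N‖_E` and `‖f‖_E`; it
vanishes as `N → ∞` when `cF * x ^ β < 1`. -/
theorem norm_add_norm_le_geometric_sum (hTF : T.carrier ≤ F.carrier) (hFE : F.carrier ≤ E.carrier)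
    {C β cT cF cE x : ℝ} (hC : 0 < C) (hβ : 0 < β)
    (hB : ∀ f : T.carrier, F.norm (Submodule.inclusion hTF f) ≤
      C * T.norm f ^ β * E.norm (Submodule.inclusion (hTF.trans hFE) f))
    (hcT0 : 0 < cT) (hcT : ∀ f g, T.norm (f + g) ≤ cT * (T.norm f + T.norm g))
    (hcF0 : 0 < cF) (hcF : ∀ f g, F.norm (f + g) ≤ cF * (F.norm f + F.norm g))
    (hcE0 : 0 < cE) (hcE : ∀ f g, E.norm (f + g) ≤ cE * (E.norm f + E.norm g))
    (hx0 : 0 < x) (hx1 : x ≤ 1) (f : E.carrier) {s : ℝ} (hs : 0 < s) (g : ℕ → T.carrier)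
    (hg : ∀ j, T.norm (g j) ≤ x ^ j * s) (N : ℕ) :
    E.norm (f - Submodule.inclusion (hTF.trans hFE) (g 0)) +
        s ^ (-β) * F.norm (Submodule.inclusion hTF (g 0)) ≤
      (1 + cF * C * (2 * cT) ^ β * cE * (1 + (cF * x ^ β)⁻¹) + C * cE) *
        ∑ j ∈ Finset.range (N + 1),
          (cF * x ^ β) ^ j * E.norm (f - Submodule.inclusion (hTF.trans hFE) (g j)) +
      C * cE * E.norm f * (cF * x ^ β) ^ N := by
  set ι := Submodule.inclusion (hTF.trans hFE)
  set κ := Submodule.inclusion hTF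
  set ρ := cF * x ^ β with hρdef
  set d : ℕ → ℝ := fun j => E.norm (f - ι (g j))
  have hd0 : ∀ j, 0 ≤ d j := fun j => E.norm_nonneg _
  have hρ : 0 < ρ := by positivity
  have hsm : s ^ (-β) * s ^ β = 1 := by rw [← Real.rpow_add hs]; simp
  have hpow : ∀ j : ℕ, (x ^ j * s) ^ β = (x ^ β) ^ j * s ^ β := fun j => by
    rw [Real.mul_rpow (by positivity) hs.le, ← Real.rpow_natCast_mul hx0.le, mul_comm (j : ℝ),
      Real.rpow_mul_natCast hx0.le]
  have hterm : ∀ j, s ^ (-β) * (cF ^ (j + 1) * F.norm (κ (g j) - κ (g (j + 1)))) ≤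
      cF * C * (2 * cT) ^ β * cE * (ρ ^ j * (d j + d (j + 1))) := fun j => by
    have hT : T.norm (g j - g (j + 1)) ≤ 2 * cT * (x ^ j * s) := by
      refine (QuasiNormedSubspace.norm_sub_le hcT _ _).trans ?_
      have h1 := hg j
      have h2 : T.norm (g (j + 1)) ≤ x ^ j * s := (hg (j + 1)).trans
        (mul_le_mul_of_nonneg_right (pow_le_pow_of_le_one hx0.le hx1 j.le_succ) hs.le)
      nlinarith
    have hEn : E.norm (ι (g j - g (j + 1))) ≤ cE * (d j + d (j + 1)) := by
      have h := QuasiNormedSubspace.norm_sub_le hcE (f - ι (g (j + 1))) (f - ι (g j))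
      rw [sub_sub_sub_cancel_left, ← map_sub, add_comm (E.norm _)] at h
      exact h
    have hF := hB (g j - g (j + 1))
    rw [map_sub] at hF
    calc s ^ (-β) * (cF ^ (j + 1) * F.norm (κ (g j) - κ (g (j + 1))))
        ≤ s ^ (-β) * (cF ^ (j + 1) *
            (C * (2 * cT * (x ^ j * s)) ^ β * (cE * (d j + d (j + 1))))) := by
          gcongr
          refine hF.trans ?_
          have := T.norm_nonneg (g j - g (j + 1))
          have := E.norm_nonneg (ι (g j - g (j + 1)))
          gcongr
      _ = (s ^ (-β) * s ^ β) *
            (cF * C * (2 * cT) ^ β * cE * (ρ ^ j * (d j + d (j + 1)))) := by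
          rw [Real.mul_rpow (by positivity) (by positivity), hpow, hρdef]
          ring
      _ = _ := by rw [hsm, one_mul]
  have hlast : s ^ (-β) * (cF ^ N * F.norm (κ (g N))) ≤ C * cE * (ρ ^ N * (d N + E.norm f)) := by
    have hEn : E.norm (ι (g N)) ≤ cE * (d N + E.norm f) := by
      have h := QuasiNormedSubspace.norm_sub_le hcE f (f - ι (g N))
      rw [sub_sub_cancel, add_comm (E.norm _)] at h
      exact h
    calc s ^ (-β) * (cF ^ N * F.norm (κ (g N)))
        ≤ s ^ (-β) * (cF ^ N * (C * (x ^ N * s) ^ β * (cE * (d N + E.norm f)))) := by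
          gcongr
          refine (hB (g N)).trans ?_
          have := T.norm_nonneg (g N)
          have := E.norm_nonneg (ι (g N))
          gcongr
          exact hg N
      _ = (s ^ (-β) * s ^ β) * (C * cE * (ρ ^ N * (d N + E.norm f))) := by
          rw [hpow, hρdef]
          ring
      _ = _ := by rw [hsm, one_mul]
  have htel := mul_le_mul_of_nonneg_left
    (QuasiNormedSubspace.norm_le_telescope hcF0.le hcF (fun j => κ (g j)) N)
    (Real.rpow_nonneg hs.le (-β))
  rw [mul_add] at htel
  have hsum := Finset.sum_le_sum fun j (_ : j ∈ Finset.range N) => hterm j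
  rw [← Finset.mul_sum, ← Finset.mul_sum] at hsum
  have hshift := mul_le_mul_of_nonneg_left (sum_geometric_mul_shift_le hρ hd0 N)
    (show 0 ≤ cF * C * (2 * cT) ^ β * cE by positivity)
  have hmem : ∀ j ∈ Finset.range (N + 1),
      ρ ^ j * d j ≤ ∑ j ∈ Finset.range (N + 1), ρ ^ j * d j := fun j hj =>
    Finset.single_le_sum (f := fun j => ρ ^ j * d j)
      (fun i _ => mul_nonneg (pow_nonneg hρ.le i) (hd0 i)) hj
  have hzero := hmem 0 (by simp)
  have hN := mul_le_mul_of_nonneg_left (hmem N (by simp)) (show 0 ≤ C * cE by positivity)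
  rw [pow_zero, one_mul] at hzero
  change d 0 + _ ≤ _
  linear_combination htel + hsum + hshift + hzero + hN + hlast

/-- A discrete Hardy-type bound of the `K`-functional by the errors of best approximation. -/
theorem exists_peetreK_le_tsum_approxError (hTF : T.carrier ≤ F.carrier)
    (hFE : F.carrier ≤ E.carrier) {C β cF x : ℝ} (hC : 0 < C) (hβ : 0 < β)
    (hB : ∀ f : T.carrier, F.norm (Submodule.inclusion hTF f) ≤
      C * T.norm f ^ β * E.norm (Submodule.inclusion (hTF.trans hFE) f))
    (hcF0 : 0 < cF) (hcF : ∀ f g, F.norm (f + g) ≤ cF * (F.norm f + F.norm g))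
    (hx0 : 0 < x) (hx1 : x ≤ 1) (hρ1 : cF * x ^ β < 1) :
    ∃ D : ℝ, 0 < D ∧ ∀ (f : E.carrier) (s : ℝ), 0 < s →
      peetreK E F (f : A) (s ^ (-β)) ≤ ENNReal.ofReal D *
        ∑' j : ℕ, ENNReal.ofReal (cF * x ^ β) ^ j * approxError E T (f : A) (x ^ j * s) := by
  obtain ⟨cT, hcT1, hcT⟩ := T.exists_norm_add_le
  obtain ⟨cE, hcE1, hcE⟩ := E.exists_norm_add_le
  have hcT0 : 0 < cT := one_pos.trans hcT1
  have hcE0 : 0 < cE := one_pos.trans hcE1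
  set ρ := cF * x ^ β with hρdef
  have hρ : 0 < ρ := by positivity
  set D := 1 + cF * C * (2 * cT) ^ β * cE * (1 + ρ⁻¹) + C * cE with hDdef
  have hD : 0 < D := by positivity
  refine ⟨D, hD, fun f s hs => ?_⟩
  set e : ℕ → ℝ≥0∞ := fun j => approxError E T (f : A) (x ^ j * s) with hedef
  have hefin : ∀ j, e j ≠ ∞ := fun j =>
    ((approxError_coe_le f (by positivity)).trans_lt ENNReal.ofReal_lt_top).ne
  set M := D * (1 - ρ)⁻¹ + C * cE * E.norm f with hMdef
  have hN : ∀ N : ℕ, peetreK E F (f : A) (s ^ (-β)) ≤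
      ENNReal.ofReal D * ∑' j : ℕ, ENNReal.ofReal ρ ^ j * e j + ENNReal.ofReal (M * ρ ^ N) := by
    intro N
    -- The same tolerance `ρ ^ N` for all `j`: its total contribution is at most `ρ ^ N / (1 - ρ)`.
    choose g hgT hgE using fun j : ℕ => exists_norm_sub_le_approxError (hTF.trans hFE) f
      (t := x ^ j * s) (by positivity) (pow_pos hρ N)
    have hkey := norm_add_norm_le_geometric_sum hTF hFE hC hβ hB hcT0 hcT hcF0 hcF hcE0 hcE
      hx0 hx1 f hs g hgT N
    rw [← hρdef, ← hDdef] at hkey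
    have hsum : ∑ j ∈ Finset.range (N + 1),
        ρ ^ j * E.norm (f - Submodule.inclusion (hTF.trans hFE) (g j)) ≤
        ∑ j ∈ Finset.range (N + 1), ρ ^ j * (e j).toReal + (1 - ρ)⁻¹ * ρ ^ N := by
      have hgeom : ∑ j ∈ Finset.range (N + 1), ρ ^ j ≤ (1 - ρ)⁻¹ := by
        rw [← tsum_geometric_of_lt_one hρ.le hρ1]
        exact (summable_geometric_of_lt_one hρ.le hρ1).sum_le_tsum _ fun j _ => pow_nonneg hρ.le j
      calc _ ≤ ∑ j ∈ Finset.range (N + 1), ρ ^ j * ((e j).toReal + ρ ^ N) := by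
            gcongr with j _
            exact hgE j
        _ = ∑ j ∈ Finset.range (N + 1), ρ ^ j * (e j).toReal +
              (∑ j ∈ Finset.range (N + 1), ρ ^ j) * ρ ^ N := by
            simp only [mul_add, Finset.sum_add_distrib, Finset.sum_mul]
        _ ≤ _ := by gcongr
    have hle : E.norm (f - Submodule.inclusion (hTF.trans hFE) (g 0)) +
        s ^ (-β) * F.norm (Submodule.inclusion hTF (g 0)) ≤
        D * ∑ j ∈ Finset.range (N + 1), ρ ^ j * (e j).toReal + M * ρ ^ N := by
      have := mul_le_mul_of_nonneg_left hsum hD.le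
      rw [hMdef]
      linear_combination hkey + this
    have hnn : 0 ≤ ∑ j ∈ Finset.range (N + 1), ρ ^ j * (e j).toReal :=
      Finset.sum_nonneg fun j _ => by positivity
    have hM : 0 ≤ M := by
      have := E.norm_nonneg f
      have : 0 < 1 - ρ := sub_pos.mpr hρ1
      positivity
    calc peetreK E F (f : A) (s ^ (-β)) ≤ ENNReal.ofReal
          (E.norm (f - Submodule.inclusion (hTF.trans hFE) (g 0)) +
            s ^ (-β) * F.norm (Submodule.inclusion hTF (g 0))) := by
          refine iInf_le_of_le _ (iInf_le_of_le _ (iInf_le_of_le ?_ le_rfl))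
          simp
      _ ≤ ENNReal.ofReal
          (D * ∑ j ∈ Finset.range (N + 1), ρ ^ j * (e j).toReal + M * ρ ^ N) :=
          ENNReal.ofReal_le_ofReal hle
      _ = ENNReal.ofReal D * ∑ j ∈ Finset.range (N + 1), ENNReal.ofReal ρ ^ j * e j +
            ENNReal.ofReal (M * ρ ^ N) := by
          rw [ENNReal.ofReal_add (by positivity) (by positivity), ENNReal.ofReal_mul hD.le,
            ENNReal.ofReal_sum_of_nonneg fun j _ => by positivity]
          congr 2
          refine Finset.sum_congr rfl fun j _ => ?_
          rw [ENNReal.ofReal_mul (by positivity), ENNReal.ofReal_pow hρ.le,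
            ENNReal.ofReal_toReal (hefin j)]
      _ ≤ _ := by
          gcongr
          exact ENNReal.sum_le_tsum _
  refine ge_of_tendsto' (f := fun N : ℕ => ENNReal.ofReal D * ∑' j : ℕ, ENNReal.ofReal ρ ^ j * e j +
    ENNReal.ofReal (M * ρ ^ N)) (x := Filter.atTop) ?_ hN
  have hlim : Filter.Tendsto (fun N : ℕ => ENNReal.ofReal (M * ρ ^ N)) Filter.atTop
      (nhds (ENNReal.ofReal (M * 0))) :=
    ENNReal.tendsto_ofReal ((tendsto_pow_atTop_nhds_zero_of_lt_one hρ.le hρ1).const_mul M)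
  simpa using hlim.const_add (ENNReal.ofReal D * ∑' j : ℕ, ENNReal.ofReal ρ ^ j * e j)

/-! ### Comparison of the quasi-norms -/

theorem exists_approxNorm_le_interpNorm {C β : ℝ} (hC : 0 < C) (hβ : 0 < β)
    (hJ : ∀ f : F.carrier, ∀ t : ℝ, 0 < t →
      ENNReal.ofReal (t ^ β) * approxError E T (f : A) t ≤ ENNReal.ofReal (C * F.norm f))
    (θ : ℝ) {q : ℝ≥0∞} (hq : 0 < q) :
    ∃ C' : ℝ, 0 < C' ∧ ∀ f : A,
      approxNorm E T (θ * β) q f ≤ ENNReal.ofReal C' * interpNorm E F θ q f := by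
  obtain ⟨D, hD, hle⟩ := exists_approxError_le_peetreK hC hJ
  have hβ' : 0 < |(-β)|⁻¹ := inv_pos.mpr (abs_pos.mpr (neg_ne_zero.mpr hβ.ne'))
  refine ⟨D * |(-β)|⁻¹ ^ (1 / q.toReal), by positivity, fun f => ?_⟩
  calc approxNorm E T (θ * β) q f
      ≤ haarLpNorm q (fun t => ENNReal.ofReal D *
          (ENNReal.ofReal ((t ^ (-β)) ^ (-θ)) * peetreK E F f (t ^ (-β)))) := by
        refine haarLpNorm_mono fun t ht => ?_
        rw [← Real.rpow_mul ht.le, neg_mul_neg, mul_comm β θ, mul_left_comm]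
        gcongr
        exact hle f t ht
    _ = _ := by
        rw [haarLpNorm_const_mul hq ENNReal.ofReal_ne_top,
          haarLpNorm_comp_rpow q (neg_ne_zero.mpr hβ.ne')
            (fun u => ENNReal.ofReal (u ^ (-θ)) * peetreK E F f u),
          ENNReal.ofReal_mul hD.le, ENNReal.ofReal_rpow_of_pos hβ', mul_assoc]
        rfl

theorem exists_interpNorm_le_approxNorm (hTF : T.carrier ≤ F.carrier)
    (hFE : F.carrier ≤ E.carrier) {C β : ℝ} (hC : 0 < C) (hβ : 0 < β)
    (hB : ∀ f : T.carrier, F.norm (Submodule.inclusion hTF f) ≤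
      C * T.norm f ^ β * E.norm (Submodule.inclusion (hTF.trans hFE) f))
    {θ : ℝ} (hθ0 : 0 < θ) (hθ1 : θ < 1) {q : ℝ≥0∞} (hq : 0 < q) :
    ∃ C' : ℝ, 0 < C' ∧ ∀ f : E.carrier,
      interpNorm E F θ q (f : A) ≤ ENNReal.ofReal C' * approxNorm E T (θ * β) q (f : A) := by
  obtain ⟨cF, hcF1, hcF⟩ := F.exists_norm_add_le
  have hcF0 : 0 < cF := one_pos.trans hcF1
  have hγ : 0 < β * (1 - θ) := mul_pos hβ (sub_pos.mpr hθ1)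
  -- Chosen so that `cF * x ^ β * x ^ (-θβ) = 1 / 4 = (1 / 2) ^ 2`.
  set x : ℝ := (4 * cF)⁻¹ ^ (β * (1 - θ))⁻¹ with hx
  have hx0 : 0 < x := by positivity
  have hx1 : x ≤ 1 := Real.rpow_le_one (by positivity)
    (inv_le_one_of_one_le₀ (by linarith)) (by positivity)
  have hxγ : x ^ (β * (1 - θ)) = (4 * cF)⁻¹ := by
    rw [hx, Real.rpow_inv_rpow (by positivity) hγ.ne']
  have hratio : cF * x ^ β = 1 / 4 * x ^ (θ * β) := by
    have : x ^ β = x ^ (β * (1 - θ)) * x ^ (θ * β) := by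
      rw [← Real.rpow_add hx0]
      ring_nf
    rw [this, hxγ]
    field_simp
  have hxθ : x ^ (θ * β) ≤ 1 := Real.rpow_le_one hx0.le hx1 (by positivity)
  obtain ⟨D, hD, hle⟩ := exists_peetreK_le_tsum_approxError hTF hFE hC hβ hB hcF0 hcF hx0 hx1
    (by rw [hratio]; linarith)
  obtain ⟨M, hM, hsum⟩ := exists_haarLpNorm_geometric_sum_le hq
    (r := ENNReal.ofReal (1 / 2)) (by rw [ENNReal.ofReal_lt_one]; norm_num) hx0
  have hβ' : (-β)⁻¹ ≠ 0 := inv_ne_zero (neg_ne_zero.mpr hβ.ne')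
  set κ : ℝ≥0∞ := ENNReal.ofReal |(-β)⁻¹|⁻¹ ^ (1 / q.toReal)
  have hκ : κ ≠ ∞ := ENNReal.rpow_ne_top_of_nonneg (by positivity) ENNReal.ofReal_ne_top
  have hfin : κ * (ENNReal.ofReal D * M) ≠ ∞ :=
    ENNReal.mul_ne_top hκ (ENNReal.mul_ne_top ENNReal.ofReal_ne_top hM)
  -- `+ 1` only makes the constant positive.
  refine ⟨(κ * (ENNReal.ofReal D * M)).toReal + 1, by positivity, fun f => ?_⟩
  set φ : ℝ → ℝ≥0∞ := fun t => ENNReal.ofReal (t ^ (θ * β)) * approxError E T (f : A) t with hφ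
  have hφm : Measurable φ := by
    have := (approxError_antitone (E := E) (T := T) (f : A)).measurable
    fun_prop
  set ψ : ℝ → ℝ≥0∞ := fun s => ENNReal.ofReal (s ^ (θ * β)) * peetreK E F (f : A) (s ^ (-β))
  have hψ : ∀ s, 0 < s → ψ s ≤ ENNReal.ofReal D *
      ∑' j : ℕ, (ENNReal.ofReal (1 / 2) ^ j * ENNReal.ofReal (1 / 2) ^ j) * φ (x ^ j * s) := by
    intro s hs
    calc ψ s ≤ ENNReal.ofReal (s ^ (θ * β)) * (ENNReal.ofReal D * ∑' j : ℕ,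
          ENNReal.ofReal (cF * x ^ β) ^ j * approxError E T (f : A) (x ^ j * s)) := by
          dsimp only [ψ]
          gcongr
          exact hle f s hs
      _ = _ := by
          rw [mul_left_comm, ← ENNReal.tsum_mul_left]
          congr 2
          ext j
          rw [hφ, ← mul_assoc, ← mul_assoc, ← mul_pow, ← ENNReal.ofReal_mul (by norm_num),
            ← ENNReal.ofReal_pow (by positivity), ← ENNReal.ofReal_pow (by positivity),
            ← ENNReal.ofReal_mul (by positivity), ← ENNReal.ofReal_mul (by positivity), hratio,
            Real.mul_rpow (by positivity) hs.le, ← Real.rpow_natCast_mul hx0.le,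
            mul_comm (j : ℝ), Real.rpow_mul_natCast hx0.le]
          congr 2
          ring
  calc interpNorm E F θ q (f : A) = haarLpNorm q (fun t => ψ (t ^ (-β)⁻¹)) := by
        refine le_antisymm ?_ ?_ <;>
        · refine haarLpNorm_mono fun t ht => le_of_eq ?_
          dsimp only [ψ]
          rw [Real.rpow_inv_rpow ht.le (neg_ne_zero.mpr hβ.ne'), ← Real.rpow_mul ht.le]
          congr 3
          field_simp
    _ = κ * haarLpNorm q ψ := haarLpNorm_comp_rpow q hβ' ψ
    _ ≤ κ * (ENNReal.ofReal D * (M * haarLpNorm q φ)) := by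
        gcongr
        refine (haarLpNorm_mono hψ).trans ?_
        rw [haarLpNorm_const_mul hq ENNReal.ofReal_ne_top]
        gcongr
        exact hsum φ hφm
    _ = κ * (ENNReal.ofReal D * M) * approxNorm E T (θ * β) q (f : A) := by
        simp only [mul_assoc]
        rfl
    _ ≤ _ := by
        gcongr
        exact (ENNReal.le_ofReal_iff_toReal_le hfin (by positivity)).mpr (by linarith)

end

theorem theorem3p4 {𝕜 A : Type*} [RCLike 𝕜] [AddCommGroup A] [Module 𝕜 A]
    (T F E : QuasiNormedSubspace 𝕜 A)
    (hTF : T.carrier ≤ F.carrier) (hFE : F.carrier ≤ E.carrier)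
    (hE : E.IsComplete) (hF : F.IsComplete) :
    (∀ C β : ℝ, 0 < C → 0 < β →
      (∀ f : F.carrier, ∀ t : ℝ, 0 < t →
        ENNReal.ofReal (t ^ β) * approxError E T (f : A) t ≤ ENNReal.ofReal (C * F.norm f)) →
      ∀ (θ : ℝ) (q : ℝ≥0∞), 0 < θ → θ < 1 → 0 < q →
        interpSpace E F θ q ⊆ approxSpace E T (θ * β) q ∧
        ∃ C' : ℝ, 0 < C' ∧ ∀ f ∈ interpSpace E F θ q,
          approxNorm E T (θ * β) q f ≤ ENNReal.ofReal C' * interpNorm E F θ q f) ∧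
    (∀ C β : ℝ, 0 < C → 0 < β →
      (∀ f : T.carrier,
        F.norm (Submodule.inclusion hTF f) ≤
          C * T.norm f ^ β * E.norm (Submodule.inclusion (hTF.trans hFE) f)) →
      ∀ (θ : ℝ) (q : ℝ≥0∞), 0 < θ → θ < 1 → 0 < q →
        approxSpace E T (θ * β) q ⊆ interpSpace E F θ q ∧
        ∃ C' : ℝ, 0 < C' ∧ ∀ f ∈ approxSpace E T (θ * β) q,
          interpNorm E F θ q f ≤ ENNReal.ofReal C' * approxNorm E T (θ * β) q f) := by
  have hE_mem : ∀ {G : QuasiNormedSubspace 𝕜 A} {f : A}, G.carrier ≤ E.carrier →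
      f ∈ E.carrier ⊔ G.carrier → f ∈ E.carrier := fun hG hf => by
    rwa [sup_eq_left.mpr hG] at hf
  refine ⟨fun C β hC hβ hJ θ q hθ0 hθ1 hq => ?_, fun C β hC hβ hB θ q hθ0 hθ1 hq => ?_⟩
  · obtain ⟨C', hC', h⟩ := exists_approxNorm_le_interpNorm hC hβ hJ θ hq
    exact ⟨fun f hf => ⟨Submodule.mem_sup_left (hE_mem hFE hf.1),
      (h f).trans_lt (ENNReal.mul_lt_top ENNReal.ofReal_lt_top hf.2)⟩, C', hC', fun f _ => h f⟩
  · obtain ⟨C', hC', h⟩ := exists_interpNorm_le_approxNorm hTF hFE hC hβ hB hθ0 hθ1 hq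
    have h' : ∀ f ∈ approxSpace E T (θ * β) q,
        interpNorm E F θ q f ≤ ENNReal.ofReal C' * approxNorm E T (θ * β) q f := fun f hf =>
      h ⟨f, hE_mem (hTF.trans hFE) hf.1⟩
    exact ⟨fun f hf => ⟨Submodule.mem_sup_left (hE_mem (hTF.trans hFE) hf.1),
      (h' f hf).trans_lt (ENNReal.mul_lt_top ENNReal.ofReal_lt_top hf.2)⟩, C', hC', h'⟩
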